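/- Let $k$ be a commutative ring with $1$. By a $k$-algebra we mean a commutative associative $k$-algebra, not necessarily with identity; $\mathbf{Alg}$ is the category of $k$-algebras and $k$-algebra homomorphisms, and $\mathbf{SimpAlg}$ is the category of simplicial objects in $\mathbf{Alg}$. An action of an algebra $R$ on an algebra $C$ is a $k$-bilinear map $R\times C\to C$, $(r,c)\mapsto r\cdot c$, with $(rs)\cdot c=r\cdot(s\cdot c)$ and $r\cdot(cc')=(r\cdot c)c'$. A \emph{2-crossed complex} is a sequence of $k$-algebra homomorphisms $$\cdots\to C_n\xrightarrow{\partial_n}C_{n-1}\to\cdots\to C_3\xrightarrow{\partial_3}C_2\xrightarrow{\partial_2}C_1\xrightarrow{\partial_1}C_0$$ with $\partial_n\partial_{n+1}=0$ for $n\ge 1$, together with an action of $C_0$ on every $C_n$ (by multiplication on $C_0$) for which each $\partial_n$ is $C_0$-equivariant, an action of $C_1$ on $C_2$, and a $k$-bilinear map (Peiffer lifting) $\{\ \otimes\ \}:C_1\times C_1\to C_2$, such that: (a) $\partial_2:C_2\to C_1$ is a crossed module, i.e. $\partial_2(y\cdot x)=y\,\partial_2(x)$ and $\partial_2(x)\cdot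 x'=xx'$, and $z\cdot(y\cdot x)=(z\cdot y)\cdot x=y\cdot(z\cdot x)$ for $z\in C_0$, $y\in C_1$, $x,x'\in C_2$; (b) for $x,x_1,x_2\in C_2$, $y,y_0,y_1,y_2\in C_1$, $z\in C_0$: $\partial_2\{y_0\otimes y_1\}=y_0y_1-\partial_1(y_1)\cdot y_0$; $\{\partial_2x_1\otimes\partial_2x_2\}=x_1x_2$; $\{y_0\otimes y_1y_2\}=\{y_0y_1\otimes y_2\}+\partial_1(y_2)\cdot\{y_0\otimes y_1\}$; $\{\partial_2x\otimes y\}=y\cdot x-\partial_1(y)\cdot x$; $\{y\otimes\partial_2x\}=y\cdot x$; $z\cdot\{y_0\otimes y_1\}=\{z\cdot y_0\otimes y_1\}=\{y_0\otimes z\cdot y_1\}$; (c) for $n\ge 3$, $C_n$ is a module over $C_0/\partial_1(C_1)$: it has zero multiplication, and $\partial_1(C_1)$ acts trivially on it. A morphism of 2-crossed complexes is a family of algebra homomorphisms $C_n\to C_n'$ commuting with the maps $\partial_n$, the actions and the Peiffer liftings. This gives the category $\mathbf{2\text{-}CrsComp}$. For a simplicial algebra $\mathbf E$ let $NE_n=\bigcap_{i=0}^{n-1}\mathrm{Ker}(d_i:E_n\to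 E_{n-1})$ (so $NE_0=E_0$), with differential $\partial_n:NE_n\to NE_{n-1}$ the restriction of $d_n$. Let $D_n\subseteq E_n$ be generated by the degenerate elements $s_iy$, either as a subalgebra for all $n$ and all $\mathbf E$, or as an ideal of $E_n$ for all $n$ and all $\mathbf E$. With either choice of $D_n$ there is a functor $\mathbf C^{(2)}:\mathbf{SimpAlg}\to\mathbf{2\text{-}CrsComp}$ whose terms are (up to isomorphism, natural in $\mathbf E$) the quotient algebras $$C_0=NE_0,\qquad C_1=NE_1,\qquad C_2=\frac{NE_2}{\partial_3(NE_3\cap D_3)},\qquad C_n=\frac{NE_n}{(NE_n\cap D_n)+\partial_{n+1}(NE_{n+1}\cap D_{n+1})}\quad(n\ge 3).$$ Under these identifications the maps $\partial_n$ are induced by the differential of $\mathbf{NE}$; $z\in C_0$ acts on $C_n$ by multiplication by $s_0^n(z)$; $y\in C_1$ acts on $C_2$ by multiplication by $s_1(y)$; the Peiffer lifting sends $(y_0,y_1)$ to the class of $s_1(y_0)\,(s_1(y_1)-s_0(y_1))$; and $\mathbf C^{(2)}$ sends a morphism of simplicial algebras to the morphism that it induces on these quotients. -/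

import Mathlib

open CategoryTheory
open scoped Simplicial

universe u v

namespace TwoCrossed

/-- Commutative (associative) algebras over the commutative ground ring `k`, not required to have
a multiplicative identity. -/
structure CAlg (k : Type u) [CommRing k] where
  carrier : Type v
  [ring : NonUnitalCommRing carrier]
  [module : Module k carrier]
  [isScalarTower : IsScalarTower k carrier carrier]
  [smulCommClass : SMulCommClass k carrier carrier]

attribute [instance] CAlg.ring CAlg.module CAlg.isScalarTower CAlg.smulCommClass

instance (k : Type u) [CommRing k] : CoeSort (CAlg.{u, v} k) (Type v) := ⟨CAlg.carrier⟩

/-- The category `Alg` of commutative `k`-algebras: morphisms are the `k`-linear multiplicative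
maps. -/
instance (k : Type u) [CommRing k] : Category (CAlg.{u, v} k) where
  Hom A B := A →ₙₐ[k] B
  id A := NonUnitalAlgHom.id k A
  comp f g := NonUnitalAlgHom.comp g f

/-- The category `SimpAlg` of simplicial commutative `k`-algebras. -/
abbrev SimpAlg (k : Type u) [CommRing k] := SimplicialObject (CAlg.{u, v} k)

section Simplicial

variable {k : Type u} [CommRing k]

/-- The face operator `dᵢ : E_{n+1} → E_n`, `0 ≤ i ≤ n + 1`. -/
def face (E : SimpAlg.{u, v} k) (n : ℕ) (i : Fin (n + 2)) : E _⦋n + 1⦌ →ₙₐ[k] E _⦋n⦌ := E.δ i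

/-- The degeneracy operator `sᵢ : E_n → E_{n+1}`, `0 ≤ i ≤ n`. -/
def degen (E : SimpAlg.{u, v} k) (n : ℕ) (i : Fin (n + 1)) : E _⦋n⦌ →ₙₐ[k] E _⦋n + 1⦌ := E.σ i

/-- The total degeneracy `s₀ⁿ : E_0 → E_n`, induced by the unique map `[n] → [0]`. -/
def totalDegen (E : SimpAlg.{u, v} k) (n : ℕ) : E _⦋0⦌ →ₙₐ[k] E _⦋n⦌ :=
  E.map (SimplexCategory.const ⦋n⦌ ⦋0⦌ 0).op

/-- The component in degree `n` of a morphism of simplicial algebras. -/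
def component {E E' : SimpAlg.{u, v} k} (f : E ⟶ E') (n : ℕ) : E _⦋n⦌ →ₙₐ[k] E' _⦋n⦌ :=
  f.app (Opposite.op ⦋n⦌)

theorem face_face (E : SimpAlg.{u, v} k) (n : ℕ) {i j : Fin (n + 2)} (h : i ≤ j)
    (x : E _⦋n + 2⦌) :
    face E n i (face E (n + 1) j.succ x) = face E n j (face E (n + 1) i.castSucc x) :=
  congrArg (fun g : E _⦋n + 2⦌ →ₙₐ[k] E _⦋n⦌ => g x) (E.δ_comp_δ h)

theorem face_component {E E' : SimpAlg.{u, v} k} (f : E ⟶ E') (n : ℕ) (i : Fin (n + 2))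
    (x : E _⦋n + 1⦌) :
    face E' n i (component f (n + 1) x) = component f n (face E n i x) :=
  congrArg (fun g : E _⦋n + 1⦌ →ₙₐ[k] E' _⦋n⦌ => g x) (SimplicialObject.δ_naturality f i).symm

/-- The Moore complex: `NE_n = ⋂_{i < n} Ker (dᵢ : E_n → E_{n-1})`, so that `NE_0 = E_0`. -/
def NE (E : SimpAlg.{u, v} k) (n : ℕ) : NonUnitalSubalgebra k (E _⦋n⦌) :=
  match n with
  | 0 => ⊤
  | n + 1 =>
    { carrier := {x | ∀ i : Fin (n + 1), face E n i.castSucc x = 0}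
      add_mem' := fun {x y} hx hy i => by rw [map_add, hx i, hy i, add_zero]
      zero_mem' := fun i => map_zero _
      mul_mem' := fun {x y} hx _ i => by rw [map_mul, hx i, zero_mul]
      smul_mem' := fun c x hx i => by rw [map_smul, hx i, smul_zero] }

theorem mul_mem_NE (E : SimpAlg.{u, v} k) (n : ℕ) (a : E _⦋n⦌) {x : E _⦋n⦌}
    (hx : x ∈ NE E n) : a * x ∈ NE E n :=
  match n, a, x, hx with
  | 0, _, _, _ => NonUnitalAlgebra.mem_top
  | _ + 1, _, _, hx => fun i => by rw [map_mul, hx i, mul_zero]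

theorem component_mem_NE {E E' : SimpAlg.{u, v} k} (f : E ⟶ E') (n : ℕ) {x : E _⦋n⦌}
    (hx : x ∈ NE E n) : component f n x ∈ NE E' n :=
  match n, x, hx with
  | 0, _, _ => NonUnitalAlgebra.mem_top
  | _ + 1, _, hx => fun i => by rw [face_component, hx i, map_zero]

theorem lastFace_mem_NE (E : SimpAlg.{u, v} k) (n : ℕ) {x : E _⦋n + 1⦌}
    (hx : x ∈ NE E (n + 1)) : face E n (Fin.last (n + 1)) x ∈ NE E n :=
  match n, x, hx with
  | 0, _, _ => NonUnitalAlgebra.mem_top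
  | n + 1, x, hx => fun i => by
    have h := face_face E n (i := i.castSucc) (j := Fin.last (n + 1)) (Fin.le_last _) x
    rw [Fin.succ_last, hx i.castSucc, map_zero] at h
    exact h

/-- The differential `∂ : NE_{n+1} → NE_n`, the restriction of the last face `d_{n+1}`. -/
def NEd (E : SimpAlg.{u, v} k) (n : ℕ) : NE E (n + 1) →ₗ[k] NE E n where
  toFun x := ⟨face E n (Fin.last (n + 1)) x, lastFace_mem_NE E n x.2⟩
  map_add' x y := Subtype.ext (map_add (face E n (Fin.last (n + 1))) (x : E _⦋n + 1⦌) y)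
  map_smul' c x := Subtype.ext (map_smul (face E n (Fin.last (n + 1))) c (x : E _⦋n + 1⦌))

/-- The map `NE_n → NE'_n` induced by a morphism of simplicial algebras. -/
def NEmap {E E' : SimpAlg.{u, v} k} (f : E ⟶ E') (n : ℕ) (x : NE E n) : NE E' n :=
  ⟨component f n x, component_mem_NE f n x.2⟩

/-- Multiplication of an element of `NE_n` by an element of `E_n` (`NE_n` is an ideal of `E_n`). -/
def mulNE (E : SimpAlg.{u, v} k) (n : ℕ) (a : E _⦋n⦌) (x : NE E n) : NE E n :=
  ⟨a * x, mul_mem_NE E n a x.2⟩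

theorem peiffer_mem_NE (E : SimpAlg.{u, v} k) (x y : NE E 1) :
    degen E 1 1 x * (degen E 1 1 y - degen E 1 0 y) ∈ NE E 2 := by
  have h0 : face E 1 0 (degen E 1 1 x) = 0 := by
    have h := congrArg (fun g : E _⦋1⦌ →ₙₐ[k] E _⦋1⦌ => g x)
      (E.δ_comp_σ_of_le (i := (0 : Fin 2)) (j := (0 : Fin 1)) (Fin.zero_le _))
    refine Eq.trans h ?_
    change degen E 0 0 (face E 0 (Fin.castSucc 0) (x : E _⦋1⦌)) = 0
    rw [x.2 0, map_zero]
  have h1 : face E 1 1 (degen E 1 1 y) = y :=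
    congrArg (fun g : E _⦋1⦌ →ₙₐ[k] E _⦋1⦌ => g y) (E.δ_comp_σ_self (i := (1 : Fin 2)))
  have h2 : face E 1 1 (degen E 1 0 y) = y :=
    congrArg (fun g : E _⦋1⦌ →ₙₐ[k] E _⦋1⦌ => g y) (E.δ_comp_σ_succ (i := (0 : Fin 2)))
  intro i
  fin_cases i
  · change face E 1 0 _ = 0
    rw [map_mul, h0, zero_mul]
  · change face E 1 1 _ = 0
    rw [map_mul, map_sub, h1, h2, sub_self, mul_zero]

/-- The element `s₁x (s₁y - s₀y)` of `NE_2`, for `x`, `y` in `NE_1`. -/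
def peiffer (E : SimpAlg.{u, v} k) (x y : NE E 1) : NE E 2 :=
  ⟨degen E 1 1 x * (degen E 1 1 y - degen E 1 0 y), peiffer_mem_NE E x y⟩

/-- The degenerate elements of `E_n`: those of the form `sᵢ y` (none for `n = 0`). -/
def degenerate (E : SimpAlg.{u, v} k) (n : ℕ) : Set (E _⦋n⦌) :=
  match n with
  | 0 => ∅
  | n + 1 => {x | ∃ (i : Fin (n + 1)) (y : E _⦋n⦌), degen E n i y = x}

/-- The two current conventions for the degenerate part `D_n` of `E_n`. -/
inductive DegenerateConvention where
  /-- `D_n` is the subalgebra of `E_n` generated by the degenerate elements. -/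
  | subalgebra
  /-- `D_n` is the ideal of `E_n` generated by the degenerate elements. -/
  | ideal

/-- The ideal of a (non-unital) `k`-algebra generated by a subset: the least `k`-submodule that
contains the subset and absorbs multiplication. -/
def idealSpan {A : CAlg.{u, v} k} (s : Set A) : Submodule k A :=
  sInf {M | s ⊆ M ∧ ∀ a : A, ∀ x ∈ M, a * x ∈ M}

/-- The degenerate part `D_n` of `E_n`. -/
def D (conv : DegenerateConvention) (E : SimpAlg.{u, v} k) (n : ℕ) : Submodule k (E _⦋n⦌) :=
  match conv with
  | .subalgebra => (NonUnitalAlgebra.adjoin k (degenerate E n)).toSubmodule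
  | .ideal => idealSpan (degenerate E n)

/-- `NE_n ∩ D_n`, as a submodule of `NE_n`. -/
def NEcapD (conv : DegenerateConvention) (E : SimpAlg.{u, v} k) (n : ℕ) : Submodule k (NE E n) :=
  (D conv E n).comap (NE E n).toSubmodule.subtype

/-- The submodule of `NE_n` that is divided out: `0` for `n = 0, 1`; `∂₃(NE_3 ∩ D_3)` for `n = 2`;
and `(NE_n ∩ D_n) + ∂_{n+1}(NE_{n+1} ∩ D_{n+1})` for `n ≥ 3`. -/
def relations (conv : DegenerateConvention) (E : SimpAlg.{u, v} k) (n : ℕ) :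
    Submodule k (NE E n) :=
  match n with
  | 0 => ⊥
  | 1 => ⊥
  | 2 => (NEcapD conv E 3).map (NEd E 2)
  | n + 3 => NEcapD conv E (n + 3) ⊔ (NEcapD conv E (n + 4)).map (NEd E (n + 3))

end Simplicial

/-- A 2-crossed complex of commutative `k`-algebras
`⋯ → C_n → C_{n-1} → ⋯ → C_3 → C_2 → C_1 → C_0`. -/
structure TwoCrsComp (k : Type u) [CommRing k] where
  C : ℕ → CAlg.{u, v} k
  /-- The boundary `∂_{n+1} : C_{n+1} → C_n`. -/
  d (n : ℕ) : C (n + 1) →ₙₐ[k] C n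
  d_d (n : ℕ) (x : C (n + 2)) : d n (d (n + 1) x) = 0
  /-- The action of `C_0` on `C_n`, by multiplication for `n = 0`. -/
  act (n : ℕ) : C 0 →ₗ[k] C n →ₗ[k] C n
  act_zero (r x : C 0) : act 0 r x = r * x
  mul_act (n : ℕ) (r s : C 0) (x : C n) : act n (r * s) x = act n r (act n s x)
  act_mul (n : ℕ) (r : C 0) (x y : C n) : act n r (x * y) = act n r x * y
  d_act (n : ℕ) (r : C 0) (x : C (n + 1)) : d n (act (n + 1) r x) = act n r (d n x)
  /-- The action of `C_1` on `C_2`, for which `∂_2 : C_2 → C_1` is a crossed module. -/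
  act₁ : C 1 →ₗ[k] C 2 →ₗ[k] C 2
  mul_act₁ (y y' : C 1) (x : C 2) : act₁ (y * y') x = act₁ y (act₁ y' x)
  act₁_mul (y : C 1) (x x' : C 2) : act₁ y (x * x') = act₁ y x * x'
  act_act₁ (r : C 0) (y : C 1) (x : C 2) : act 2 r (act₁ y x) = act₁ (act 1 r y) x
  act₁_act (r : C 0) (y : C 1) (x : C 2) : act 2 r (act₁ y x) = act₁ y (act 2 r x)
  d_act₁ (y : C 1) (x : C 2) : d 1 (act₁ y x) = y * d 1 x
  act₁_d (x x' : C 2) : act₁ (d 1 x) x' = x * x'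
  /-- The Peiffer lifting `{ ⊗ } : C_1 ⊗_{C_0} C_1 → C_2`. -/
  lift : C 1 →ₗ[k] C 1 →ₗ[k] C 2
  d_lift (y₀ y₁ : C 1) : d 1 (lift y₀ y₁) = y₀ * y₁ - act 1 (d 0 y₁) y₀
  lift_d_d (x₁ x₂ : C 2) : lift (d 1 x₁) (d 1 x₂) = x₁ * x₂
  lift_mul (y₀ y₁ y₂ : C 1) :
    lift y₀ (y₁ * y₂) = lift (y₀ * y₁) y₂ + act 2 (d 0 y₂) (lift y₀ y₁)
  lift_d_left (x : C 2) (y : C 1) : lift (d 1 x) y = act₁ y x - act 2 (d 0 y) x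
  lift_d_right (y : C 1) (x : C 2) : lift y (d 1 x) = act₁ y x
  lift_act_left (r : C 0) (y₀ y₁ : C 1) : lift (act 1 r y₀) y₁ = act 2 r (lift y₀ y₁)
  lift_act_right (r : C 0) (y₀ y₁ : C 1) : lift y₀ (act 1 r y₁) = act 2 r (lift y₀ y₁)
  /-- For `n ≥ 3`, `∂_1(C_1)` acts trivially on `C_n`: the action is one of `C_0 / ∂_1(C_1)`. -/
  act_d (n : ℕ) (hn : 3 ≤ n) (y : C 1) (x : C n) : act n (d 0 y) x = 0
  /-- For `n ≥ 3`, `C_n` is just a module, that is, an algebra with zero multiplication. -/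
  mul_eq_zero (n : ℕ) (hn : 3 ≤ n) (x x' : C n) : x * x' = 0

namespace TwoCrsComp

variable {k : Type u} [CommRing k]

/-- A morphism of 2-crossed complexes: a morphism of chain complexes of algebras compatible with
the actions and with the Peiffer liftings. -/
@[ext]
structure Hom (X Y : TwoCrsComp.{u, v} k) where
  f (n : ℕ) : X.C n →ₙₐ[k] Y.C n
  f_d (n : ℕ) (x : X.C (n + 1)) : f n (X.d n x) = Y.d n (f (n + 1) x)
  f_act (n : ℕ) (r : X.C 0) (x : X.C n) : f n (X.act n r x) = Y.act n (f 0 r) (f n x)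
  f_act₁ (y : X.C 1) (x : X.C 2) : f 2 (X.act₁ y x) = Y.act₁ (f 1 y) (f 2 x)
  f_lift (y₀ y₁ : X.C 1) : f 2 (X.lift y₀ y₁) = Y.lift (f 1 y₀) (f 1 y₁)

/-- The category `2-CrsComp` of 2-crossed complexes. -/
instance : Category (TwoCrsComp.{u, v} k) where
  Hom := Hom
  id X :=
    { f := fun n => NonUnitalAlgHom.id k (X.C n)
      f_d := fun _ _ => rfl
      f_act := fun _ _ _ => rfl
      f_act₁ := fun _ _ => rfl
      f_lift := fun _ _ => rfl }
  comp {X Y Z} g h :=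
    { f := fun n => (h.f n).comp (g.f n)
      f_d := fun n x => by simp [g.f_d, h.f_d]
      f_act := fun n r x => by simp [g.f_act, h.f_act]
      f_act₁ := fun y x => by simp [g.f_act₁, h.f_act₁]
      f_lift := fun y₀ y₁ => by simp [g.f_lift, h.f_lift] }

/-- The component in degree `n` of a morphism of 2-crossed complexes. -/
def component {X Y : TwoCrsComp.{u, v} k} (g : X ⟶ Y) (n : ℕ) : X.C n →ₙₐ[k] Y.C n :=
  Hom.f g n

end TwoCrsComp

end TwoCrossed

/-!
Every axiom of a 2-crossed complex is either an identity in the Moore complex or an equation in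
`C_n`, `n ≥ 2`, modulo boundaries of degenerate elements. The latter come from one principle. If
`p, u ∈ D_{n+1}` are such that `dⱼ` is the only one of the faces `d₀, …, d_n` that may be nonzero
on `p`, and `dⱼ u = 0`, then `p u ∈ NE_{n+1} ∩ D_{n+1}`, so that `d_{n+1} p · d_{n+1} u` vanishes
in `C_n`. For `x ∈ NE_n` the alternating sum `∑_{i ≥ j} (-1)^{n-i} sᵢ x` is such a `p`, and its last
face is `x` up to degenerate elements; hence, up to elements of `D_n`, the last face of any
`u ∈ D_{n+1}` with a vanishing face `dⱼ u`, `j ≤ n`, annihilates `C_n`.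

The action of `∂y`, `y ∈ NE_1`, telescopes: `s₀ⁿ d₁ y` is joined to `s₀ⁿ d₀ y = 0` by the iterated
degeneracies of `y` along the monotone maps `[n] → [1]`, and consecutive ones are the last faces of
degenerate elements of `E_{n+1}` that have a face in common.
-/

namespace TwoCrossed

variable {k : Type u} [CommRing k]

section SimplicialIdentities

variable (E : SimpAlg.{u, v} k)

theorem face_degen_of_le (n : ℕ) {i : Fin (n + 2)} {j : Fin (n + 1)} (h : i ≤ j.castSucc)
    (x : E _⦋n + 1⦌) :
    face E (n + 1) i.castSucc (degen E (n + 1) j.succ x) = degen E n j (face E n i x) :=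
  congrArg (fun g : E _⦋n + 1⦌ →ₙₐ[k] E _⦋n + 1⦌ => g x) (E.δ_comp_σ_of_le h)

theorem face_castSucc_degen_self (n : ℕ) (i : Fin (n + 1)) (x : E _⦋n⦌) :
    face E n i.castSucc (degen E n i x) = x :=
  congrArg (fun g : E _⦋n⦌ →ₙₐ[k] E _⦋n⦌ => g x) E.δ_comp_σ_self

theorem face_succ_degen_self (n : ℕ) (i : Fin (n + 1)) (x : E _⦋n⦌) :
    face E n i.succ (degen E n i x) = x :=
  congrArg (fun g : E _⦋n⦌ →ₙₐ[k] E _⦋n⦌ => g x) E.δ_comp_σ_succ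

theorem face_degen_of_gt (n : ℕ) {i : Fin (n + 2)} {j : Fin (n + 1)} (h : j.castSucc < i)
    (x : E _⦋n + 1⦌) :
    face E (n + 1) i.succ (degen E (n + 1) j.castSucc x) = degen E n j (face E n i x) :=
  congrArg (fun g : E _⦋n + 1⦌ →ₙₐ[k] E _⦋n + 1⦌ => g x) (E.δ_comp_σ_of_gt h)

theorem lastFace_degen_last (n : ℕ) (x : E _⦋n⦌) :
    face E n (Fin.last (n + 1)) (degen E n (Fin.last n) x) = x :=
  face_succ_degen_self E n (Fin.last n) x

theorem lastFace_degen_castSucc (n : ℕ) (j : Fin (n + 1)) (x : E _⦋n + 1⦌) :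
    face E (n + 1) (Fin.last (n + 2)) (degen E (n + 1) j.castSucc x) =
      degen E n j (face E n (Fin.last (n + 1)) x) :=
  face_degen_of_gt E n (i := Fin.last (n + 1)) (Fin.castSucc_lt_last j) x

theorem face_degen_last_eq_zero (n : ℕ) {i : Fin (n + 1)} {x : E _⦋n + 1⦌}
    (hx : face E n i.castSucc x = 0) :
    face E (n + 1) i.castSucc.castSucc (degen E (n + 1) (Fin.last (n + 1)) x) = 0 :=
  (face_degen_of_le E n (Fin.castSucc_le_castSucc_iff.2 i.le_last) x).trans
    (by rw [hx, map_zero])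

theorem face_degen_eq_zero_of_mem_NE (n : ℕ) {x : E _⦋n⦌} (hx : x ∈ NE E n) {i j : Fin (n + 1)}
    (hij : i ≠ j) (hij' : i.castSucc ≠ j.succ) : face E n i.castSucc (degen E n j x) = 0 := by
  cases n with
  | zero => exact absurd (Subsingleton.elim (α := Fin 1) i j) hij
  | succ n =>
    rcases lt_or_gt_of_ne hij with h | h
    · obtain ⟨j, rfl⟩ := Fin.exists_succ_eq.2 (Fin.ne_zero_of_lt h)
      obtain ⟨i, rfl⟩ := Fin.exists_castSucc_eq.2 (Fin.ne_last_of_lt h)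
      rw [face_degen_of_le E n (Fin.castSucc_lt_succ_iff.1 h), hx i, map_zero]
    · obtain ⟨i, rfl⟩ := Fin.exists_succ_eq.2 (Fin.ne_zero_of_lt h)
      obtain ⟨j, rfl⟩ := Fin.exists_castSucc_eq.2 (Fin.ne_last_of_lt h)
      have hji : j.castSucc < i.castSucc :=
        lt_of_le_of_ne (Fin.castSucc_lt_succ_iff.1 h) fun e => hij' (congrArg Fin.succ e.symm)
      exact (face_degen_of_gt E n hji x).trans (by rw [hx i, map_zero])

theorem face_degen_of_mem_NE (n : ℕ) {x : E _⦋n⦌} (hx : x ∈ NE E n) (i j : Fin (n + 1)) :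
    face E n i.castSucc (degen E n j x) = if i = j ∨ i.castSucc = j.succ then x else 0 := by
  split_ifs with h
  · rcases h with rfl | h
    · exact face_castSucc_degen_self E n i x
    · rw [h, face_succ_degen_self]
  · exact face_degen_eq_zero_of_mem_NE E n hx (fun e => h (.inl e)) fun e => h (.inr e)

/-- The algebra homomorphism `E_c → E_b` induced by a monotone map `f : [b] → [c]`. -/
def operator {b c : SimplexCategory} (f : b ⟶ c) :
    E.obj (Opposite.op c) →ₙₐ[k] E.obj (Opposite.op b) :=
  E.map f.op

theorem operator_operator {a b c : SimplexCategory} {f : a ⟶ b} {g : b ⟶ c} {h : a ⟶ c}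
    (w : f ≫ g = h) (x : E.obj (Opposite.op c)) :
    operator E f (operator E g x) = operator E h x := by
  subst w
  unfold operator
  rw [op_comp, E.map_comp]
  rfl

theorem totalDegen_zero (x : E _⦋0⦌) : totalDegen E 0 x = x := by
  have h : SimplexCategory.const ⦋0⦌ ⦋0⦌ 0 = 𝟙 _ := Subsingleton.elim _ _
  unfold totalDegen
  rw [h, op_id, E.map_id]
  rfl

theorem face_totalDegen (n : ℕ) (i : Fin (n + 2)) (x : E _⦋0⦌) :
    face E n i (totalDegen E (n + 1) x) = totalDegen E n x :=
  operator_operator E (Subsingleton.elim _ _) x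

theorem degen_totalDegen (n : ℕ) (i : Fin (n + 1)) (x : E _⦋0⦌) :
    degen E n i (totalDegen E n x) = totalDegen E (n + 1) x :=
  operator_operator E (Subsingleton.elim _ _) x

theorem degen_zero_eq_totalDegen (x : E _⦋0⦌) : degen E 0 0 x = totalDegen E 1 x := by
  rw [← degen_totalDegen E 0 0, totalDegen_zero]

theorem component_degen {E' : SimpAlg.{u, v} k} (f : E ⟶ E') (n : ℕ) (i : Fin (n + 1))
    (x : E _⦋n⦌) :
    component f (n + 1) (degen E n i x) = degen E' n i (component f n x) :=
  congrArg (fun g : E _⦋n⦌ →ₙₐ[k] E' _⦋n + 1⦌ => g x) (SimplicialObject.σ_naturality f i)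

theorem component_totalDegen {E' : SimpAlg.{u, v} k} (f : E ⟶ E') (n : ℕ) (x : E _⦋0⦌) :
    component f n (totalDegen E n x) = totalDegen E' n (component f 0 x) :=
  congrArg (fun g : E _⦋0⦌ →ₙₐ[k] E' _⦋n⦌ => g x)
    (f.naturality (SimplexCategory.const ⦋n⦌ ⦋0⦌ 0).op)

end SimplicialIdentities

section Cut

variable (E : SimpAlg.{u, v} k)

/-- The monotone map `[m] → [1]` that is `0` exactly on the vertices `i < j`; `j` may exceed `m`. -/
def cutMap (m j : ℕ) : ⦋m⦌ ⟶ ⦋1⦌ :=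
  SimplexCategory.mkHom (n := m) (m := 1)
    ⟨fun i => if i.val < j then 0 else 1, fun a b h => by
      have : a.val ≤ b.val := h
      dsimp only
      split_ifs <;> first | omega | simp⟩

/-- The iterated degeneracy `E_1 → E_m` induced by `cutMap m j`. As `j` runs from `0` to `m + 1` it
leads from `s₀ᵐ d₀` to `s₀ᵐ d₁`, two consecutive values having the same `j`-th face. -/
def cut (m j : ℕ) : E _⦋1⦌ →ₙₐ[k] E _⦋m⦌ :=
  operator E (cutMap m j)

theorem face_cut (m j : ℕ) (i : Fin (m + 2)) (y : E _⦋1⦌) :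
    face E m i (cut E (m + 1) j y) = cut E m (if i.val < j then j - 1 else j) y := by
  refine operator_operator E ?_ y
  ext a : 3
  change (if (i.succAbove a).val < j then (0 : Fin 2) else 1) = if a.val < _ then 0 else 1
  congr 1
  rw [Fin.succAbove]
  simp only [Fin.lt_def, Fin.val_castSucc, eq_iff_iff]
  split_ifs <;> simp <;> omega

theorem face_cut_sub_cut_succ_eq_zero (m : ℕ) (i : Fin (m + 2)) (y : E _⦋1⦌) :
    face E m i (cut E (m + 1) i y - cut E (m + 1) (i + 1) y) = 0 := by
  rw [map_sub, face_cut, face_cut, if_neg (lt_irrefl _), if_pos (Nat.lt_succ_self _),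
    Nat.add_sub_cancel, sub_self]

theorem lastFace_cut (m : ℕ) {j : ℕ} (hj : j ≤ m + 1) (y : E _⦋1⦌) :
    face E m (Fin.last (m + 1)) (cut E (m + 1) j y) = cut E m j y := by
  rw [face_cut, Fin.val_last, if_neg hj.not_gt]

theorem cut_zero (m : ℕ) (y : E _⦋1⦌) : cut E m 0 y = totalDegen E m (face E 0 0 y) := by
  refine (operator_operator E ?_ y).symm
  ext a : 3
  rfl

theorem cut_succ_self (m : ℕ) (y : E _⦋1⦌) :
    cut E m (m + 1) y = totalDegen E m (face E 0 (Fin.last 1) y) := by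
  refine (operator_operator E ?_ y).symm
  ext a : 3
  change 0 = if a.val < m + 1 then (0 : Fin 2) else 1
  rw [if_pos a.2]

theorem cut_two_two (y : E _⦋1⦌) : cut E 2 2 y = degen E 1 0 y := by
  have h : cutMap 2 2 = SimplexCategory.σ 0 := by
    ext a : 3
    fin_cases a <;> rfl
  exact congrArg (fun f => operator E f y) h

end Cut

section DegeneratePart

theorem subset_idealSpan {A : CAlg.{u, v} k} (s : Set A) : s ⊆ idealSpan s :=
  fun _ hx => Submodule.mem_sInf.2 fun _ hM => hM.1 hx

theorem mul_mem_idealSpan {A : CAlg.{u, v} k} (s : Set A) (a : A) {x : A} (hx : x ∈ idealSpan s) :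
    a * x ∈ idealSpan s :=
  Submodule.mem_sInf.2 fun M hM => hM.2 a x (Submodule.mem_sInf.1 hx M hM)

theorem idealSpan_le {A : CAlg.{u, v} k} {s : Set A} {M : Submodule k A} (hs : s ⊆ M)
    (hM : ∀ a : A, ∀ x ∈ M, a * x ∈ M) : idealSpan s ≤ M :=
  sInf_le ⟨hs, hM⟩

variable (conv : DegenerateConvention) (E : SimpAlg.{u, v} k)

theorem degenerate_subset_D (n : ℕ) : degenerate E n ⊆ D conv E n := by
  cases conv
  · exact NonUnitalAlgebra.subset_adjoin k
  · exact subset_idealSpan _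

theorem degen_mem_D (n : ℕ) (i : Fin (n + 1)) (y : E _⦋n⦌) : degen E n i y ∈ D conv E (n + 1) :=
  degenerate_subset_D conv E (n + 1) ⟨i, y, rfl⟩

theorem mul_mem_D (n : ℕ) {a b : E _⦋n⦌} (ha : a ∈ D conv E n) (hb : b ∈ D conv E n) :
    a * b ∈ D conv E n := by
  cases conv
  · exact mul_mem (S := NonUnitalSubalgebra k (E _⦋n⦌)) ha hb
  · exact mul_mem_idealSpan _ a hb

theorem component_mem_D_of_mem_degenerate {E E' : SimpAlg.{u, v} k} (f : E ⟶ E') (n : ℕ)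
    {x : E _⦋n⦌} (hx : x ∈ degenerate E n) : component f n x ∈ D conv E' n := by
  cases n with
  | zero => exact hx.elim
  | succ n =>
    obtain ⟨i, y, rfl⟩ := hx
    rw [component_degen]
    exact degen_mem_D conv E' n i _

theorem component_mem_D {E E' : SimpAlg.{u, v} k} (f : E ⟶ E') (n : ℕ) {x : E _⦋n⦌}
    (hx : x ∈ D conv E n) : component f n x ∈ D conv E' n := by
  have hdegenerate := fun y => component_mem_D_of_mem_degenerate conv f n (x := y)
  cases conv
  · exact (NonUnitalAlgebra.adjoin_le (S := NonUnitalSubalgebra.comap (component f n)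
      (NonUnitalAlgebra.adjoin k (degenerate E' n))) hdegenerate) hx
  · refine idealSpan_le (M := (D .ideal E' n).comap (component f n : E _⦋n⦌ →ₗ[k] E' _⦋n⦌))
      hdegenerate (fun a x hx => ?_) hx
    change component f n (a * x) ∈ D .ideal E' n
    rw [map_mul]
    exact mul_mem_idealSpan _ _ hx

theorem totalDegen_mem_D {n : ℕ} (hn : n ≠ 0) (x : E _⦋0⦌) : totalDegen E n x ∈ D conv E n := by
  obtain ⟨n, rfl⟩ := Nat.exists_eq_succ_of_ne_zero hn
  rw [← degen_totalDegen E n 0]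
  exact degen_mem_D conv E n 0 _

theorem cut_mem_D {n : ℕ} (hn : 2 ≤ n) (j : ℕ) (y : E _⦋1⦌) : cut E n j y ∈ D conv E n := by
  obtain ⟨n, rfl⟩ := Nat.exists_eq_add_of_le' hn
  have hcut : ¬Function.Injective (cutMap (n + 2) j).toOrderHom := fun h => by
    simpa using Fintype.card_le_of_injective _ h
  obtain ⟨i, g, h⟩ := SimplexCategory.eq_σ_comp_of_not_injective _ hcut
  exact degenerate_subset_D conv E _ ⟨i, _, operator_operator E h.symm y⟩

end DegeneratePart

section MooreComplex

variable (E : SimpAlg.{u, v} k)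

theorem coe_NEd (n : ℕ) (x : NE E (n + 1)) :
    (NEd E n x : E _⦋n⦌) = face E n (Fin.last (n + 1)) x := rfl

theorem coe_mulNE (n : ℕ) (a : E _⦋n⦌) (x : NE E n) : (mulNE E n a x : E _⦋n⦌) = a * x := rfl

theorem coe_peiffer (y₀ y₁ : NE E 1) :
    (peiffer E y₀ y₁ : E _⦋2⦌) = degen E 1 1 y₀ * (degen E 1 1 y₁ - degen E 1 0 y₁) := rfl

/-- The differential `NEd`, as an algebra homomorphism. -/
def NEdHom (n : ℕ) : NE E (n + 1) →ₙₐ[k] NE E n where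
  __ := NEd E n
  map_zero' := map_zero (NEd E n)
  map_mul' x y := Subtype.ext (map_mul (face E n (Fin.last (n + 1))) (x : E _⦋n + 1⦌) y)

/-- The map `NEmap` induced by a morphism, as an algebra homomorphism. -/
def NEmapHom {E E' : SimpAlg.{u, v} k} (f : E ⟶ E') (n : ℕ) : NE E n →ₙₐ[k] NE E' n where
  toFun := NEmap f n
  map_smul' c x := Subtype.ext (map_smul (component f n) c (x : E _⦋n⦌))
  map_zero' := Subtype.ext (map_zero (component f n))
  map_add' x y := Subtype.ext (map_add (component f n) (x : E _⦋n⦌) y)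
  map_mul' x y := Subtype.ext (map_mul (component f n) (x : E _⦋n⦌) y)

/-- The multiplication `mulNE : E_n × NE_n → NE_n`, as a bilinear map. -/
def mulNEBilin (n : ℕ) : E _⦋n⦌ →ₗ[k] NE E n →ₗ[k] NE E n :=
  LinearMap.mk₂ k (mulNE E n)
    (fun a b x => Subtype.ext (add_mul a b (x : E _⦋n⦌)))
    (fun c a x => Subtype.ext (smul_mul_assoc c a (x : E _⦋n⦌)))
    (fun a x y => Subtype.ext (mul_add a (x : E _⦋n⦌) y))
    (fun c a x => Subtype.ext (mul_smul_comm c a (x : E _⦋n⦌)))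

/-- The Peiffer lifting `peiffer : NE_1 × NE_1 → NE_2`, as a bilinear map. -/
def peifferBilin : NE E 1 →ₗ[k] NE E 1 →ₗ[k] NE E 2 :=
  LinearMap.mk₂ k (peiffer E)
    (fun x y z => Subtype.ext (by simp [peiffer, add_mul]))
    (fun c x y => Subtype.ext (by simp [peiffer, smul_mul_assoc]))
    (fun x y z => Subtype.ext (by simp [peiffer, mul_sub, mul_add]; abel))
    (fun c x y => Subtype.ext (by simp [peiffer, ← smul_sub, mul_smul_comm]))

theorem zero_mulNE (n : ℕ) (x : NE E n) : mulNE E n 0 x = 0 :=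
  Subtype.ext (zero_mul (x : E _⦋n⦌))

theorem sub_mulNE (n : ℕ) (a b : E _⦋n⦌) (x : NE E n) :
    mulNE E n (a - b) x = mulNE E n a x - mulNE E n b x :=
  Subtype.ext (sub_mul a b (x : E _⦋n⦌))

theorem mul_mulNE (n : ℕ) (a b : E _⦋n⦌) (x : NE E n) :
    mulNE E n (a * b) x = mulNE E n a (mulNE E n b x) :=
  Subtype.ext (mul_assoc a b (x : E _⦋n⦌))

theorem mulNE_map_mul (n : ℕ) {A : CAlg.{u, v} k} (f : A →ₙₐ[k] E _⦋n⦌) (a b : A) (x : NE E n) :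
    mulNE E n (f (a * b)) x = mulNE E n (f a) (mulNE E n (f b) x) := by
  rw [map_mul, mul_mulNE]

theorem mulNE_mul (n : ℕ) (a : E _⦋n⦌) (x y : NE E n) : mulNE E n a (x * y) = mulNE E n a x * y :=
  Subtype.ext (mul_assoc a (x : E _⦋n⦌) y).symm

theorem mulNE_left_comm (n : ℕ) (a b : E _⦋n⦌) (x : NE E n) :
    mulNE E n a (mulNE E n b x) = mulNE E n b (mulNE E n a x) :=
  Subtype.ext (mul_left_comm a b (x : E _⦋n⦌))

theorem NEd_NEd (n : ℕ) (x : NE E (n + 2)) : NEd E n (NEd E (n + 1) x) = 0 := by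
  refine Subtype.ext ((face_face E n (i := Fin.last (n + 1)) (j := Fin.last (n + 1)) le_rfl
    (x : E _⦋n + 2⦌)).trans ?_)
  rw [x.2 (Fin.last (n + 1)), map_zero]
  rfl

theorem NEd_mulNE (n : ℕ) (a : E _⦋n + 1⦌) (x : NE E (n + 1)) :
    NEd E n (mulNE E (n + 1) a x) = mulNE E n (face E n (Fin.last (n + 1)) a) (NEd E n x) :=
  Subtype.ext (map_mul (face E n (Fin.last (n + 1))) a (x : E _⦋n + 1⦌))

theorem NEd_mulNE_degen_last (n : ℕ) (a : E _⦋n⦌) (x : NE E (n + 1)) :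
    NEd E n (mulNE E (n + 1) (degen E n (Fin.last n) a) x) = mulNE E n a (NEd E n x) := by
  rw [NEd_mulNE, lastFace_degen_last]

theorem NEd_mulNE_totalDegen (n : ℕ) (r : E _⦋0⦌) (x : NE E (n + 1)) :
    NEd E n (mulNE E (n + 1) (totalDegen E (n + 1) r) x) =
      mulNE E n (totalDegen E n r) (NEd E n x) := by
  rw [NEd_mulNE, face_totalDegen]

theorem mulNE_totalDegen_zero (r x : NE E 0) : mulNE E 0 (totalDegen E 0 r) x = r * x := by
  rw [totalDegen_zero]
  rfl

theorem mulNE_degen_mulNE_totalDegen (n : ℕ) (i : Fin (n + 1)) (r : E _⦋0⦌) (y : NE E n)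
    (x : NE E (n + 1)) :
    mulNE E (n + 1) (degen E n i (mulNE E n (totalDegen E n r) y)) x =
      mulNE E (n + 1) (totalDegen E (n + 1) r) (mulNE E (n + 1) (degen E n i y) x) := by
  rw [← mul_mulNE, coe_mulNE, map_mul, degen_totalDegen]

theorem NEd_peiffer (y₀ y₁ : NE E 1) :
    NEd E 1 (peiffer E y₀ y₁) = y₀ * y₁ - mulNE E 1 (totalDegen E 1 (NEd E 0 y₁)) y₀ := by
  have hdegen₁ (y : E _⦋1⦌) : face E 1 (Fin.last 2) (degen E 1 1 y) = y :=
    lastFace_degen_last E 1 y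
  have hdegen₀ : face E 1 (Fin.last 2) (degen E 1 0 y₁) = totalDegen E 1 (NEd E 0 y₁) :=
    (lastFace_degen_castSucc E 0 0 (y₁ : E _⦋1⦌)).trans (degen_zero_eq_totalDegen E _)
  refine Subtype.ext ?_
  rw [coe_NEd, coe_peiffer, map_mul, map_sub, hdegen₁, hdegen₁, hdegen₀, mul_sub,
    mul_comm _ (totalDegen E 1 _)]
  rfl

theorem peiffer_mul (y₀ y₁ y₂ : NE E 1) :
    peiffer E y₀ (y₁ * y₂) =
      peiffer E (y₀ * y₁) y₂ + mulNE E 2 (degen E 1 0 y₂) (peiffer E y₀ y₁) := by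
  refine Subtype.ext ?_
  simp only [NonUnitalSubalgebra.coe_add, NonUnitalSubalgebra.coe_mul, coe_mulNE, coe_peiffer,
    map_mul, mul_sub, mul_comm, mul_left_comm]
  abel

theorem peiffer_mulNE_totalDegen_left (r : E _⦋0⦌) (y₀ y₁ : NE E 1) :
    peiffer E (mulNE E 1 (totalDegen E 1 r) y₀) y₁ =
      mulNE E 2 (totalDegen E 2 r) (peiffer E y₀ y₁) := by
  refine Subtype.ext ?_
  simp only [coe_mulNE, coe_peiffer, map_mul, degen_totalDegen, mul_assoc]

theorem peiffer_mulNE_totalDegen_right (r : E _⦋0⦌) (y₀ y₁ : NE E 1) :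
    peiffer E y₀ (mulNE E 1 (totalDegen E 1 r) y₁) =
      mulNE E 2 (totalDegen E 2 r) (peiffer E y₀ y₁) := by
  refine Subtype.ext ?_
  simp only [coe_mulNE, coe_peiffer, map_mul, degen_totalDegen, ← mul_sub, mul_left_comm]

variable {E} {E' : SimpAlg.{u, v} k} (f : E ⟶ E')

theorem NEmap_NEd (n : ℕ) (x : NE E (n + 1)) :
    NEmap f n (NEd E n x) = NEd E' n (NEmap f (n + 1) x) :=
  Subtype.ext (face_component f n _ _).symm

theorem NEmap_mulNE (n : ℕ) (a : E _⦋n⦌) (x : NE E n) :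
    NEmap f n (mulNE E n a x) = mulNE E' n (component f n a) (NEmap f n x) :=
  Subtype.ext (map_mul (component f n) a (x : E _⦋n⦌))

theorem NEmap_mulNE_totalDegen (n : ℕ) (r : NE E 0) (x : NE E n) :
    NEmap f n (mulNE E n (totalDegen E n r) x) =
      mulNE E' n (totalDegen E' n (NEmap f 0 r)) (NEmap f n x) := by
  rw [NEmap_mulNE, component_totalDegen]
  rfl

theorem NEmap_mulNE_degen (n : ℕ) (i : Fin (n + 1)) (y : NE E n) (x : NE E (n + 1)) :
    NEmap f (n + 1) (mulNE E (n + 1) (degen E n i y) x) =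
      mulNE E' (n + 1) (degen E' n i (NEmap f n y)) (NEmap f (n + 1) x) := by
  rw [NEmap_mulNE, component_degen]
  rfl

theorem NEmap_peiffer (y₀ y₁ : NE E 1) :
    NEmap f 2 (peiffer E y₀ y₁) = peiffer E' (NEmap f 1 y₀) (NEmap f 1 y₁) := by
  refine Subtype.ext ((map_mul (component f 2) _ _).trans ?_)
  rw [map_sub, component_degen, component_degen, component_degen]
  rfl

end MooreComplex

section Relations

variable (conv : DegenerateConvention) (E : SimpAlg.{u, v} k)

theorem mem_relations_of_mem_D {n : ℕ} (hn : 3 ≤ n) {x : NE E n} (hx : (x : E _⦋n⦌) ∈ D conv E n) :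
    x ∈ relations conv E n := by
  obtain ⟨n, rfl⟩ := Nat.exists_eq_add_of_le' hn
  exact Submodule.mem_sup_left hx

theorem NEd_mem_relations_of_mem_D {n : ℕ} (hn : 2 ≤ n) {w : NE E (n + 1)}
    (hw : (w : E _⦋n + 1⦌) ∈ D conv E (n + 1)) : NEd E n w ∈ relations conv E n :=
  match n, hn, w, hw with
  | 2, _, _, hw => Submodule.mem_map_of_mem hw
  | _ + 3, _, _, hw => Submodule.mem_sup_right (Submodule.mem_map_of_mem hw)

theorem relations_le {n : ℕ} {M : Submodule k (NE E n)}
    (hD : 3 ≤ n → ∀ x : NE E n, (x : E _⦋n⦌) ∈ D conv E n → x ∈ M)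
    (hd : 2 ≤ n → ∀ w : NE E (n + 1), (w : E _⦋n + 1⦌) ∈ D conv E (n + 1) → NEd E n w ∈ M) :
    relations conv E n ≤ M :=
  match n with
  | 0 => bot_le
  | 1 => bot_le
  | 2 => Submodule.map_le_iff_le_comap.2 (hd le_rfl)
  | n + 3 =>
    sup_le (hD (Nat.le_add_left 3 n)) (Submodule.map_le_iff_le_comap.2 (hd (by omega)))

theorem NEmap_mem_relations {E E' : SimpAlg.{u, v} k} (f : E ⟶ E') (n : ℕ) {x : NE E n}
    (hx : x ∈ relations conv E n) : NEmap f n x ∈ relations conv E' n := by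
  refine relations_le conv E
    (M := (relations conv E' n).comap (NEmapHom f n : NE E n →ₗ[k] NE E' n))
    (fun hn x hx => ?_) (fun hn w hw => ?_) hx
  · exact mem_relations_of_mem_D conv E' hn (component_mem_D conv f n hx)
  · change NEmap f n (NEd E n w) ∈ relations conv E' n
    rw [NEmap_NEd]
    exact NEd_mem_relations_of_mem_D conv E' hn (component_mem_D conv f (n + 1) hw)

theorem NEd_mem_relations (n : ℕ) {x : NE E (n + 1)} (hx : x ∈ relations conv E (n + 1)) :
    NEd E n x ∈ relations conv E n := by
  refine relations_le conv E (M := (relations conv E n).comap (NEd E n))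
    (fun hn x hx => ?_) (fun _ w _ => ?_) hx
  · exact NEd_mem_relations_of_mem_D conv E (by omega) hx
  · rw [Submodule.mem_comap, NEd_NEd]
    exact zero_mem _

theorem mulNE_mem_relations {n : ℕ} {a : E _⦋n⦌} (ha : 3 ≤ n → a ∈ D conv E n) {x : NE E n}
    (hx : x ∈ relations conv E n) : mulNE E n a x ∈ relations conv E n := by
  refine relations_le conv E (M := (relations conv E n).comap (mulNEBilin E n a))
    (fun hn x hx => ?_) (fun hn w hw => ?_) hx
  · exact mem_relations_of_mem_D conv E hn (mul_mem_D conv E n (ha hn) hx)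
  · change mulNE E n a (NEd E n w) ∈ relations conv E n
    rw [← NEd_mulNE_degen_last]
    exact NEd_mem_relations_of_mem_D conv E hn
      (mul_mem_D conv E (n + 1) (degen_mem_D conv E n _ a) hw)

theorem mulNE_totalDegen_mem_relations {n : ℕ} (r : E _⦋0⦌) {x : NE E n}
    (hx : x ∈ relations conv E n) : mulNE E n (totalDegen E n r) x ∈ relations conv E n :=
  mulNE_mem_relations conv E (fun hn => totalDegen_mem_D conv E (by omega) r) hx

theorem mul_mem_NE_of_complementary_faces (n : ℕ) {p u : E _⦋n + 1⦌} (j : Fin (n + 1))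
    (hp : ∀ i ≠ j, face E n i.castSucc p = 0) (hu : face E n j.castSucc u = 0) :
    p * u ∈ NE E (n + 1) := fun i => by
  rw [map_mul]
  rcases eq_or_ne i j with rfl | hij
  · rw [hu, mul_zero]
  · rw [hp i hij, zero_mul]

theorem mem_relations_of_complementary_faces {n : ℕ} (hn : 2 ≤ n) {p u : E _⦋n + 1⦌}
    (hpD : p ∈ D conv E (n + 1)) (huD : u ∈ D conv E (n + 1)) (j : Fin (n + 1))
    (hp : ∀ i ≠ j, face E n i.castSucc p = 0) (hu : face E n j.castSucc u = 0) {z : NE E n}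
    (hz : (z : E _⦋n⦌) = face E n (Fin.last (n + 1)) p * face E n (Fin.last (n + 1)) u) :
    z ∈ relations conv E n := by
  have hzd : z = NEd E n ⟨p * u, mul_mem_NE_of_complementary_faces E n j hp hu⟩ :=
    Subtype.ext (hz.trans (map_mul _ p u).symm)
  rw [hzd]
  exact NEd_mem_relations_of_mem_D conv E hn (mul_mem_D conv E (n + 1) hpD huD)

theorem mulNE_lastFace_mem_relations {n : ℕ} (hn : 2 ≤ n) {u : E _⦋n + 1⦌}
    (huD : u ∈ D conv E (n + 1)) (hu : face E n (Fin.last n).castSucc u = 0) (x : NE E n) :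
    mulNE E n (face E n (Fin.last (n + 1)) u) x ∈ relations conv E n := by
  have hface : ∀ i ≠ Fin.last n, face E n i.castSucc (degen E n (Fin.last n) x) = 0 :=
    fun i hi => face_degen_eq_zero_of_mem_NE E n x.2 hi (Fin.castSucc_lt_last i).ne
  refine mem_relations_of_complementary_faces conv E hn (degen_mem_D conv E n _ (x : E _⦋n⦌)) huD
    _ hface hu ?_
  rw [coe_mulNE, lastFace_degen_last, mul_comm]

-- `ε = (-1)^{n-j}` and `p = ∑_{i ≥ j} (-1)^{n-i} sᵢ x`.
theorem exists_mem_D_face_eq_ite (n : ℕ) (x : NE E n) (j : Fin (n + 1)) :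
    ∃ ε : k, ∃ p ∈ D conv E (n + 1),
      (∀ i : Fin (n + 1), face E n i.castSucc p = if i = j then ε • (x : E _⦋n⦌) else 0) ∧
      face E n (Fin.last (n + 1)) p - x ∈ D conv E n := by
  induction j using Fin.reverseInduction with
  | last =>
    refine ⟨1, _, degen_mem_D conv E n (Fin.last n) (x : E _⦋n⦌), fun i => ?_, ?_⟩
    · simp only [face_degen_of_mem_NE E n x.2, one_smul, Fin.succ_last,
        (Fin.castSucc_lt_last i).ne, or_false]
    · rw [lastFace_degen_last, sub_self]
      exact zero_mem _
  | cast j ih =>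
    obtain ⟨ε, p, hpD, hp, hlast⟩ := ih
    cases n with
    | zero => exact j.elim0
    | succ n =>
    refine ⟨-ε, p - ε • degen E (n + 1) j.castSucc x,
      sub_mem hpD (Submodule.smul_mem _ ε (degen_mem_D conv E (n + 1) _ _)), fun i => ?_, ?_⟩
    · have hsucc : i.castSucc = j.castSucc.succ ↔ i = j.succ := by
        rw [Fin.succ_castSucc, Fin.castSucc_inj]
      have hne : j.castSucc ≠ j.succ := j.castSucc_lt_succ.ne
      rw [map_sub, map_smul, hp, face_degen_of_mem_NE E (n + 1) x.2]
      simp only [hsucc]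
      by_cases hi : i = j.castSucc
      · simp [hi, hne]
      · by_cases hi' : i = j.succ <;> simp [hi, hi', hne.symm]
    · rw [map_sub, map_smul, lastFace_degen_castSucc, sub_right_comm]
      exact sub_mem hlast (Submodule.smul_mem _ ε (degen_mem_D conv E n j _))

theorem mulNE_lastFace_mem_relations_of_mem_D {n : ℕ} (hn : 3 ≤ n) {u : E _⦋n + 1⦌}
    (huD : u ∈ D conv E (n + 1)) (hlastD : face E n (Fin.last (n + 1)) u ∈ D conv E n)
    (j : Fin (n + 1)) (hu : face E n j.castSucc u = 0) (x : NE E n) :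
    mulNE E n (face E n (Fin.last (n + 1)) u) x ∈ relations conv E n := by
  obtain ⟨ε, p, hpD, hp, hlast⟩ := exists_mem_D_face_eq_ite conv E n x j
  have hpu := mul_mem_NE_of_complementary_faces E n j (fun i hi => (hp i).trans (if_neg hi)) hu
  have hboundary : NEd E n ⟨p * u, hpu⟩ ∈ relations conv E n :=
    NEd_mem_relations_of_mem_D conv E (by omega) (mul_mem_D conv E (n + 1) hpD huD)
  refine (Submodule.sub_mem_iff_right _ hboundary).1 (mem_relations_of_mem_D conv E hn ?_)
  change face E n (Fin.last (n + 1)) (p * u) - face E n (Fin.last (n + 1)) u * x ∈ D conv E n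
  rw [map_mul, mul_comm, ← mul_sub]
  exact mul_mem_D conv E n hlastD hlast

theorem mul_sub_mulNE_degen_mem_relations (n : ℕ) (x x' : NE E (n + 2)) :
    x * x' - mulNE E (n + 2) (degen E (n + 1) (Fin.last (n + 1)) (NEd E (n + 1) x)) x' ∈
      relations conv E (n + 2) := by
  have hface : face E (n + 2) (Fin.last (n + 2)).castSucc
      (degen E (n + 2) (Fin.last (n + 2)) x - degen E (n + 2) (Fin.last (n + 1)).castSucc x) =
        0 := by
    rw [map_sub, face_castSucc_degen_self]
    exact sub_eq_zero.2 (face_succ_degen_self E (n + 2) (Fin.last (n + 1)).castSucc _).symm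
  convert mulNE_lastFace_mem_relations conv E (Nat.le_add_left 2 n)
    (sub_mem (degen_mem_D conv E (n + 2) _ _) (degen_mem_D conv E (n + 2) _ _)) hface x' using 1
  rw [map_sub, lastFace_degen_last, lastFace_degen_castSucc, sub_mulNE]
  rfl

theorem mul_mem_relations {n : ℕ} (hn : 3 ≤ n) (x x' : NE E n) :
    x * x' ∈ relations conv E n := by
  obtain ⟨n, rfl⟩ := Nat.exists_eq_add_of_le' hn
  have hface : face E (n + 3) (0 : Fin (n + 4)).castSucc (degen E (n + 3) (Fin.last (n + 3))
      (degen E (n + 2) (Fin.last (n + 2)) (NEd E (n + 2) x))) = 0 :=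
    face_degen_last_eq_zero E (n + 2) (i := 0)
      (face_degen_last_eq_zero E (n + 1) (i := 0) ((NEd E (n + 2) x).2 0))
  have hact := mulNE_lastFace_mem_relations_of_mem_D conv E hn (degen_mem_D conv E (n + 3) _ _)
    (by rw [lastFace_degen_last]; exact degen_mem_D conv E (n + 2) _ _) 0 hface x'
  rw [lastFace_degen_last] at hact
  exact (Submodule.sub_mem_iff_left _ hact).1 (mul_sub_mulNE_degen_mem_relations conv E _ x x')

theorem mul_mem_relations_of_right_mem (n : ℕ) (x : NE E n) {x' : NE E n}
    (hx' : x' ∈ relations conv E n) : x * x' ∈ relations conv E n := by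
  by_cases hn : 3 ≤ n
  · exact mul_mem_relations conv E hn x x'
  · exact mulNE_mem_relations conv E (fun h => absurd h hn) hx'

theorem mulNE_cut_sub_mulNE_cut_mem_relations {n : ℕ} (hn : 3 ≤ n) (y : E _⦋1⦌) (x : NE E n)
    {j : ℕ} (hj : j ≤ n + 1) :
    mulNE E n (cut E n 0 y) x - mulNE E n (cut E n j y) x ∈ relations conv E n := by
  induction j with
  | zero => rw [sub_self]; exact zero_mem _
  | succ j ih =>
    have hstep := mulNE_lastFace_mem_relations_of_mem_D conv E hn
      (sub_mem (cut_mem_D conv E (by omega) j y) (cut_mem_D conv E (by omega) (j + 1) y))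
      (by
        rw [map_sub, lastFace_cut E n (by omega), lastFace_cut E n hj]
        exact sub_mem (cut_mem_D conv E (by omega) j y) (cut_mem_D conv E (by omega) (j + 1) y))
      ⟨j, hj⟩ (face_cut_sub_cut_succ_eq_zero E n (⟨j, hj⟩ : Fin (n + 1)).castSucc y) x
    rw [map_sub, lastFace_cut E n (by omega), lastFace_cut E n hj, sub_mulNE] at hstep
    simpa only [sub_add_sub_cancel] using add_mem (ih (by omega)) hstep

theorem mulNE_totalDegen_NEd_mem_relations {n : ℕ} (hn : 3 ≤ n) (y : NE E 1) (x : NE E n) :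
    mulNE E n (totalDegen E n (NEd E 0 y)) x ∈ relations conv E n := by
  have hd₀ : face E 0 0 (y : E _⦋1⦌) = 0 := y.2 0
  have h := mulNE_cut_sub_mulNE_cut_mem_relations conv E hn (y : E _⦋1⦌) x le_rfl
  rwa [cut_zero, hd₀, map_zero, zero_mulNE, zero_sub, neg_mem_iff, cut_succ_self] at h

theorem mulNE_degen_sub_mulNE_totalDegen_mem_relations (y : E _⦋1⦌) (x : NE E 2) :
    mulNE E 2 (degen E 1 0 y) x - mulNE E 2 (totalDegen E 2 (face E 0 (Fin.last 1) y)) x ∈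
      relations conv E 2 := by
  have h := mulNE_lastFace_mem_relations conv E le_rfl
    (sub_mem (cut_mem_D conv E (by omega) 2 y) (cut_mem_D conv E (by omega) 3 y))
    (face_cut_sub_cut_succ_eq_zero E 2 2 y) x
  rwa [map_sub, lastFace_cut E 2 (by omega), lastFace_cut E 2 le_rfl, cut_two_two, cut_succ_self,
    sub_mulNE] at h

theorem peiffer_NEd_left_sub_mem_relations (x : NE E 2) (y : NE E 1) :
    peiffer E (NEd E 1 x) y - mulNE E 2 (degen E 1 1 y - degen E 1 0 y) x ∈
      relations conv E 2 := by
  have hlast₂ (w : E _⦋2⦌) : face E 2 (Fin.last 3) (degen E 2 2 w) = w := lastFace_degen_last E 2 w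
  have hlast₁ : face E 2 (Fin.last 3) (degen E 2 1 x) = degen E 1 1 (NEd E 1 x) :=
    lastFace_degen_castSucc E 1 1 (x : E _⦋2⦌)
  have hface_p : ∀ i ≠ (1 : Fin 3), face E 2 i.castSucc (degen E 2 1 x - degen E 2 2 x) = 0 := by
    intro i hi
    rw [map_sub, face_degen_of_mem_NE E 2 x.2, face_degen_of_mem_NE E 2 x.2]
    fin_cases i <;> simp_all
  have hface_u : face E 2 (1 : Fin 3).castSucc
      (degen E 2 2 (degen E 1 1 y - degen E 1 0 y)) = 0 := by
    refine face_degen_last_eq_zero E 1 (i := 1) ?_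
    rw [map_sub]
    exact sub_eq_zero.2 ((face_castSucc_degen_self E 1 1 _).trans
      (face_succ_degen_self E 1 0 _).symm)
  refine mem_relations_of_complementary_faces conv E le_rfl
    (sub_mem (degen_mem_D conv E 2 _ _) (degen_mem_D conv E 2 _ _))
    (degen_mem_D conv E 2 _ _) 1 hface_p hface_u ?_
  rw [map_sub, hlast₂, hlast₂, hlast₁, sub_mul, mul_comm (x : E _⦋2⦌)]
  rfl

theorem peiffer_NEd_right_sub_mem_relations (y : NE E 1) (x : NE E 2) :
    peiffer E y (NEd E 1 x) - mulNE E 2 (degen E 1 1 y) x ∈ relations conv E 2 := by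
  have hlast₂ (w : E _⦋2⦌) : face E 2 (Fin.last 3) (degen E 2 2 w) = w := lastFace_degen_last E 2 w
  have hlast₁ : face E 2 (Fin.last 3) (degen E 2 1 x) = degen E 1 1 (NEd E 1 x) :=
    lastFace_degen_castSucc E 1 1 (x : E _⦋2⦌)
  have hlast₀ : face E 2 (Fin.last 3) (degen E 2 0 x) = degen E 1 0 (NEd E 1 x) :=
    lastFace_degen_castSucc E 1 0 (x : E _⦋2⦌)
  have hface_p : ∀ i ≠ (0 : Fin 3),
      face E 2 i.castSucc (degen E 2 1 x - degen E 2 0 x - degen E 2 2 x) = 0 := by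
    intro i hi
    simp only [map_sub, face_degen_of_mem_NE E 2 x.2]
    fin_cases i <;> simp_all
  have hface_u : face E 2 (0 : Fin 3).castSucc (degen E 2 2 (degen E 1 1 y)) = 0 :=
    face_degen_last_eq_zero E 1 (i := 0) (face_degen_last_eq_zero E 0 (i := 0) (y.2 0))
  refine mem_relations_of_complementary_faces conv E le_rfl
    (sub_mem (sub_mem (degen_mem_D conv E 2 _ _) (degen_mem_D conv E 2 _ _))
      (degen_mem_D conv E 2 _ _)) (degen_mem_D conv E 2 _ _) 0 hface_p hface_u ?_
  rw [map_sub, map_sub, hlast₂, hlast₂, hlast₁, hlast₀, sub_mul, mul_comm (x : E _⦋2⦌),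
    mul_comm (_ - _)]
  rfl

end Relations

section Quotient

variable {A B : Type v} [NonUnitalCommRing A] [Module k A] [IsScalarTower k A A]
  [SMulCommClass k A A] [NonUnitalCommRing B] [Module k B] [IsScalarTower k B B]
  [SMulCommClass k B B]

/-- The multiplication of the quotient of a commutative non-unital algebra by an ideal, the latter
given as a submodule that absorbs multiplication. -/
def quotientMul (I : Submodule k A) (hI : ∀ a, ∀ x ∈ I, a * x ∈ I) :
    A ⧸ I →ₗ[k] A ⧸ I →ₗ[k] A ⧸ I :=
  LinearMap.liftQ₂ I I ((LinearMap.mul k A).compr₂ I.mkQ)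
    (fun x hx => LinearMap.ext fun a =>
      (congrArg I.mkQ (mul_comm x a)).trans ((Submodule.Quotient.mk_eq_zero I).2 (hI a x hx)))
    (fun x hx => LinearMap.ext fun a => (Submodule.Quotient.mk_eq_zero I).2 (hI a x hx))

/-- The ring structure, with multiplication `quotientMul`, on the quotient of a commutative
non-unital algebra by an ideal. -/
abbrev quotientRing (I : Submodule k A) (hI : ∀ a, ∀ x ∈ I, a * x ∈ I) :
    NonUnitalCommRing (A ⧸ I) where
  __ := (inferInstance : AddCommGroup (A ⧸ I))
  mul x y := quotientMul I hI x y
  left_distrib x y z := map_add (quotientMul I hI x) y z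
  right_distrib x y z := LinearMap.map_add₂ (quotientMul I hI) x y z
  zero_mul x := LinearMap.map_zero₂ (quotientMul I hI) x
  mul_zero x := map_zero (quotientMul I hI x)
  mul_assoc := by
    rintro ⟨x⟩ ⟨y⟩ ⟨z⟩
    exact congrArg I.mkQ (mul_assoc x y z)
  mul_comm := by
    rintro ⟨x⟩ ⟨y⟩
    exact congrArg I.mkQ (mul_comm x y)

/-- The quotient of a commutative non-unital algebra by an ideal, as an object of `Alg`. -/
def quotientAlg (I : Submodule k A) (hI : ∀ a, ∀ x ∈ I, a * x ∈ I) : CAlg.{u, v} k :=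
  letI := quotientRing I hI
  { carrier := A ⧸ I
    ring := quotientRing I hI
    module := Submodule.Quotient.module I
    isScalarTower := ⟨fun c x y => LinearMap.map_smul₂ (quotientMul I hI) c x y⟩
    smulCommClass := ⟨fun c x y => (map_smul (quotientMul I hI x) c y).symm⟩ }

/-- The homomorphism of quotient algebras induced by a homomorphism that maps one ideal into the
other. -/
def quotientAlgMap (I : Submodule k A) (hI : ∀ a, ∀ x ∈ I, a * x ∈ I) (J : Submodule k B)
    (hJ : ∀ b, ∀ y ∈ J, b * y ∈ J) (f : A →ₙₐ[k] B) (hf : ∀ x ∈ I, f x ∈ J) :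
    quotientAlg I hI →ₙₐ[k] quotientAlg J hJ where
  toFun := I.mapQ J (f : A →ₗ[k] B) hf
  map_smul' c x := map_smul (I.mapQ J (f : A →ₗ[k] B) hf) c x
  map_zero' := map_zero (I.mapQ J (f : A →ₗ[k] B) hf)
  map_add' x y := map_add (I.mapQ J (f : A →ₗ[k] B) hf) x y
  map_mul' := by
    rintro ⟨x⟩ ⟨y⟩
    exact congrArg J.mkQ (map_mul f x y)

end Quotient

section MooreQuotient

variable (conv : DegenerateConvention) (E : SimpAlg.{u, v} k)

/-- The algebra `C_n`, the quotient of `NE_n` by `relations`. -/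
def mooreQuotient (n : ℕ) : CAlg.{u, v} k :=
  quotientAlg (relations conv E n) fun x _ => mul_mem_relations_of_right_mem conv E n x

namespace mooreQuotient

/-- The quotient map `NE_n → C_n`. -/
def mk (n : ℕ) : NE E n →ₗ[k] mooreQuotient conv E n :=
  (relations conv E n).mkQ

theorem mk_eq_zero {n : ℕ} {x : NE E n} : mk conv E n x = 0 ↔ x ∈ relations conv E n :=
  Submodule.Quotient.mk_eq_zero _

theorem mk_eq {n : ℕ} {x y : NE E n} :
    mk conv E n x = mk conv E n y ↔ x - y ∈ relations conv E n :=
  Submodule.Quotient.eq _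

/-- The boundary `C_{n+1} → C_n` induced by the differential of the Moore complex. -/
def boundary (n : ℕ) : mooreQuotient conv E (n + 1) →ₙₐ[k] mooreQuotient conv E n :=
  quotientAlgMap _ _ _ _ (NEdHom E n) fun _ => NEd_mem_relations conv E n

/-- The action of `C_0` on `C_n`, by multiplication through `s₀ⁿ`. -/
def act (n : ℕ) :
    mooreQuotient conv E 0 →ₗ[k] mooreQuotient conv E n →ₗ[k] mooreQuotient conv E n :=
  LinearMap.liftQ₂ (relations conv E 0) (relations conv E n)
    (((mulNEBilin E n).comp
      ((totalDegen E n : E _⦋0⦌ →ₗ[k] E _⦋n⦌).comp (NE E 0).toSubmodule.subtype)).compr₂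
        (mk conv E n))
    bot_le
    (fun _ hx => LinearMap.ext fun r =>
      (mk_eq_zero conv E).2 (mulNE_totalDegen_mem_relations conv E r hx))

/-- The action of `C_1` on `C_2`, by multiplication through `s₁`. -/
def act₁ : mooreQuotient conv E 1 →ₗ[k] mooreQuotient conv E 2 →ₗ[k] mooreQuotient conv E 2 :=
  LinearMap.liftQ₂ (relations conv E 1) (relations conv E 2)
    (((mulNEBilin E 2).comp
      ((degen E 1 1 : E _⦋1⦌ →ₗ[k] E _⦋2⦌).comp (NE E 1).toSubmodule.subtype)).compr₂
        (mk conv E 2))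
    bot_le
    (fun _ hx => LinearMap.ext fun y => (mk_eq_zero conv E).2
      (mulNE_mem_relations conv E (fun _ => degen_mem_D conv E 1 1 (y : E _⦋1⦌)) hx))

/-- The Peiffer lifting `C_1 × C_1 → C_2`. -/
def lift : mooreQuotient conv E 1 →ₗ[k] mooreQuotient conv E 1 →ₗ[k] mooreQuotient conv E 2 :=
  LinearMap.liftQ₂ (relations conv E 1) (relations conv E 1)
    ((peifferBilin E).compr₂ (mk conv E 2)) bot_le bot_le

theorem boundary_boundary (n : ℕ) (x : mooreQuotient conv E (n + 2)) :
    boundary conv E n (boundary conv E (n + 1) x) = 0 := by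
  obtain ⟨x⟩ := x
  exact congrArg (mk conv E n) (NEd_NEd E n x)

theorem act₁_boundary (x x' : mooreQuotient conv E 2) :
    act₁ conv E (boundary conv E 1 x) x' = x * x' := by
  obtain ⟨x⟩ := x
  obtain ⟨x'⟩ := x'
  exact ((mk_eq conv E).2 (mul_sub_mulNE_degen_mem_relations conv E 0 x x')).symm

theorem lift_boundary_left (x : mooreQuotient conv E 2) (y : mooreQuotient conv E 1) :
    lift conv E (boundary conv E 1 x) y =
      act₁ conv E y x - act conv E 2 (boundary conv E 0 y) x := by
  obtain ⟨x⟩ := x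
  obtain ⟨y⟩ := y
  have hpeiffer : mk conv E 2 (peiffer E (NEd E 1 x) y) =
      mk conv E 2 (mulNE E 2 (degen E 1 1 y - degen E 1 0 y) x) :=
    (mk_eq conv E).2 (peiffer_NEd_left_sub_mem_relations conv E x y)
  have hact : mk conv E 2 (mulNE E 2 (degen E 1 0 y) x) =
      mk conv E 2 (mulNE E 2 (totalDegen E 2 (NEd E 0 y)) x) :=
    (mk_eq conv E).2 (mulNE_degen_sub_mulNE_totalDegen_mem_relations conv E y x)
  rw [sub_mulNE, map_sub, hact] at hpeiffer
  exact hpeiffer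

theorem lift_boundary_right (y : mooreQuotient conv E 1) (x : mooreQuotient conv E 2) :
    lift conv E y (boundary conv E 1 x) = act₁ conv E y x := by
  obtain ⟨y⟩ := y
  obtain ⟨x⟩ := x
  exact (mk_eq conv E).2 (peiffer_NEd_right_sub_mem_relations conv E y x)

theorem lift_boundary_boundary (x₁ x₂ : mooreQuotient conv E 2) :
    lift conv E (boundary conv E 1 x₁) (boundary conv E 1 x₂) = x₁ * x₂ := by
  rw [lift_boundary_right, act₁_boundary]

theorem lift_mul (y₀ y₁ y₂ : mooreQuotient conv E 1) :
    lift conv E y₀ (y₁ * y₂) =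
      lift conv E (y₀ * y₁) y₂ + act conv E 2 (boundary conv E 0 y₂) (lift conv E y₀ y₁) := by
  obtain ⟨y₀⟩ := y₀
  obtain ⟨y₁⟩ := y₁
  obtain ⟨y₂⟩ := y₂
  have hact : mk conv E 2 (mulNE E 2 (degen E 1 0 y₂) (peiffer E y₀ y₁)) =
      mk conv E 2 (mulNE E 2 (totalDegen E 2 (NEd E 0 y₂)) (peiffer E y₀ y₁)) :=
    (mk_eq conv E).2 (mulNE_degen_sub_mulNE_totalDegen_mem_relations conv E y₂ _)
  refine (congrArg (mk conv E 2) (peiffer_mul E y₀ y₁ y₂)).trans ?_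
  rw [map_add, hact]
  rfl

theorem act_boundary {n : ℕ} (hn : 3 ≤ n) (y : mooreQuotient conv E 1)
    (x : mooreQuotient conv E n) : act conv E n (boundary conv E 0 y) x = 0 := by
  obtain ⟨y⟩ := y
  obtain ⟨x⟩ := x
  exact (mk_eq_zero conv E).2 (mulNE_totalDegen_NEd_mem_relations conv E hn y x)

theorem mul_eq_zero {n : ℕ} (hn : 3 ≤ n) (x x' : mooreQuotient conv E n) : x * x' = 0 := by
  obtain ⟨x⟩ := x
  obtain ⟨x'⟩ := x'
  exact (mk_eq_zero conv E).2 (mul_mem_relations conv E hn x x')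

variable {E} {E' : SimpAlg.{u, v} k} (f : E ⟶ E')

/-- The map `C_n → C'_n` induced by a morphism of simplicial algebras. -/
def map (n : ℕ) : mooreQuotient conv E n →ₙₐ[k] mooreQuotient conv E' n :=
  quotientAlgMap _ _ _ _ (NEmapHom f n) fun _ => NEmap_mem_relations conv f n

end mooreQuotient

open mooreQuotient

/-- The 2-crossed complex of a simplicial algebra. -/
def twoCrossedComplex : TwoCrsComp.{u, v} k where
  C := mooreQuotient conv E
  d := boundary conv E
  d_d := boundary_boundary conv E
  act := act conv E
  act_zero := by
    rintro ⟨r⟩ ⟨x⟩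
    exact congrArg (mk conv E 0) (mulNE_totalDegen_zero E r x)
  mul_act := by
    rintro n ⟨r⟩ ⟨s⟩ ⟨x⟩
    exact congrArg (mk conv E n) (mulNE_map_mul E n (totalDegen E n) (r : E _⦋0⦌) s x)
  act_mul := by
    rintro n ⟨r⟩ ⟨x⟩ ⟨y⟩
    exact congrArg (mk conv E n) (mulNE_mul E n (totalDegen E n r) x y)
  d_act := by
    rintro n ⟨r⟩ ⟨x⟩
    exact congrArg (mk conv E n) (NEd_mulNE_totalDegen E n r x)
  act₁ := act₁ conv E
  mul_act₁ := by
    rintro ⟨y⟩ ⟨y'⟩ ⟨x⟩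
    exact congrArg (mk conv E 2) (mulNE_map_mul E 2 (degen E 1 1) (y : E _⦋1⦌) y' x)
  act₁_mul := by
    rintro ⟨y⟩ ⟨x⟩ ⟨x'⟩
    exact congrArg (mk conv E 2) (mulNE_mul E 2 (degen E 1 1 y) x x')
  act_act₁ := by
    rintro ⟨r⟩ ⟨y⟩ ⟨x⟩
    exact congrArg (mk conv E 2) (mulNE_degen_mulNE_totalDegen E 1 1 r y x).symm
  act₁_act := by
    rintro ⟨r⟩ ⟨y⟩ ⟨x⟩
    exact congrArg (mk conv E 2) (mulNE_left_comm E 2 (totalDegen E 2 r) (degen E 1 1 y) x)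
  d_act₁ := by
    rintro ⟨y⟩ ⟨x⟩
    exact congrArg (mk conv E 1) (NEd_mulNE_degen_last E 1 y x)
  act₁_d := act₁_boundary conv E
  lift := lift conv E
  d_lift := by
    rintro ⟨y₀⟩ ⟨y₁⟩
    exact congrArg (mk conv E 1) (NEd_peiffer E y₀ y₁)
  lift_d_d := lift_boundary_boundary conv E
  lift_mul := lift_mul conv E
  lift_d_left := lift_boundary_left conv E
  lift_d_right := lift_boundary_right conv E
  lift_act_left := by
    rintro ⟨r⟩ ⟨y₀⟩ ⟨y₁⟩
    exact congrArg (mk conv E 2) (peiffer_mulNE_totalDegen_left E r y₀ y₁)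
  lift_act_right := by
    rintro ⟨r⟩ ⟨y₀⟩ ⟨y₁⟩
    exact congrArg (mk conv E 2) (peiffer_mulNE_totalDegen_right E r y₀ y₁)
  act_d _ := act_boundary conv E
  mul_eq_zero _ := mooreQuotient.mul_eq_zero conv E

/-- The morphism of 2-crossed complexes induced by a morphism of simplicial algebras. -/
def twoCrossedMap {E E' : SimpAlg.{u, v} k} (f : E ⟶ E') :
    twoCrossedComplex conv E ⟶ twoCrossedComplex conv E' where
  f := mooreQuotient.map conv f
  f_d := by
    rintro n ⟨x⟩
    exact congrArg (mk conv E' n) (NEmap_NEd f n x)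
  f_act := by
    rintro n ⟨r⟩ ⟨x⟩
    exact congrArg (mk conv E' n) (NEmap_mulNE_totalDegen f n r x)
  f_act₁ := by
    rintro ⟨y⟩ ⟨x⟩
    exact congrArg (mk conv E' 2) (NEmap_mulNE_degen f 1 1 y x)
  f_lift := by
    rintro ⟨y₀⟩ ⟨y₁⟩
    exact congrArg (mk conv E' 2) (NEmap_peiffer f y₀ y₁)

/-- The functor `C⁽²⁾` from simplicial algebras to 2-crossed complexes. -/
def twoCrossedFunctor : SimpAlg.{u, v} k ⥤ TwoCrsComp.{u, v} k where
  obj := twoCrossedComplex conv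
  map := twoCrossedMap conv
  map_id E := TwoCrsComp.Hom.ext <| funext fun n => NonUnitalAlgHom.ext <| by
    rintro ⟨x⟩
    rfl
  map_comp f g := TwoCrsComp.Hom.ext <| funext fun n => NonUnitalAlgHom.ext <| by
    rintro ⟨x⟩
    rfl

end MooreQuotient

end TwoCrossed

theorem mainTheorem8 (k : Type u) [CommRing k] (conv : TwoCrossed.DegenerateConvention) :
    ∃ (F : TwoCrossed.SimpAlg.{u, v} k ⥤ TwoCrossed.TwoCrsComp.{u, v} k)
      (e : ∀ (E : TwoCrossed.SimpAlg.{u, v} k) (n : ℕ),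
        (TwoCrossed.NE E n ⧸ TwoCrossed.relations conv E n) ≃ₗ[k] (F.obj E).C n),
      -- the multiplication of `C_n` is induced by that of `NE_n`
      (∀ E n (x y : TwoCrossed.NE E n),
        e E n (Submodule.Quotient.mk x) * e E n (Submodule.Quotient.mk y) =
          e E n (Submodule.Quotient.mk (x * y))) ∧
      -- the boundary is induced by the differential of `NE`
      (∀ E n (x : TwoCrossed.NE E (n + 1)),
        (F.obj E).d n (e E (n + 1) (Submodule.Quotient.mk x)) =
          e E n (Submodule.Quotient.mk (TwoCrossed.NEd E n x))) ∧
      -- `C_0` acts on `C_n` by multiplication through `s₀ⁿ`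
      (∀ E n (r : TwoCrossed.NE E 0) (x : TwoCrossed.NE E n),
        (F.obj E).act n (e E 0 (Submodule.Quotient.mk r)) (e E n (Submodule.Quotient.mk x)) =
          e E n (Submodule.Quotient.mk
            (TwoCrossed.mulNE E n (TwoCrossed.totalDegen E n r) x))) ∧
      -- `C_1` acts on `C_2` by multiplication through `s₁`
      (∀ E (y : TwoCrossed.NE E 1) (x : TwoCrossed.NE E 2),
        (F.obj E).act₁ (e E 1 (Submodule.Quotient.mk y)) (e E 2 (Submodule.Quotient.mk x)) =
          e E 2 (Submodule.Quotient.mk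
            (TwoCrossed.mulNE E 2 (TwoCrossed.degen E 1 1 y) x))) ∧
      -- the Peiffer lifting is `{y₀ ⊗ y₁} = [s₁y₀ (s₁y₁ - s₀y₁)]`
      (∀ E (y₀ y₁ : TwoCrossed.NE E 1),
        (F.obj E).lift (e E 1 (Submodule.Quotient.mk y₀)) (e E 1 (Submodule.Quotient.mk y₁)) =
          e E 2 (Submodule.Quotient.mk (TwoCrossed.peiffer E y₀ y₁))) ∧
      -- the functor sends a morphism to the morphism that it induces on the quotients
      (∀ (E E' : TwoCrossed.SimpAlg.{u, v} k) (f : E ⟶ E') (n : ℕ) (x : TwoCrossed.NE E n),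
        TwoCrossed.TwoCrsComp.component (F.map f) n (e E n (Submodule.Quotient.mk x)) =
          e E' n (Submodule.Quotient.mk (TwoCrossed.NEmap f n x))) := by
  exact ⟨TwoCrossed.twoCrossedFunctor conv, fun _ _ => LinearEquiv.refl k _,
    fun _ _ _ _ => rfl, fun _ _ _ => rfl, fun _ _ _ _ => rfl, fun _ _ _ => rfl,
    fun _ _ _ => rfl, fun _ _ _ _ _ => rfl⟩
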